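/- Let $K$ and $S$ be compact Hausdorff spaces, and let $C(K)$, $C(S)$ be the Banach spaces of real-valued continuous functions on them with the supremum norm. For $k\in K$ let $\delta_k\in C(K)^*$ be the functional $\delta_k(f)=f(k)$, and similarly $\delta_s\in C(S)^*$ for $s\in S$. Let $T\colon C(K)\to C(S)$ be a linear isometric embedding (not necessarily onto) with adjoint $T^*\colon C(S)^*\to C(K)^*$, and define $F_T\colon S\to C(K)^*$ by $F_T(s)=T^*(\delta_s)$. Call $T$ a U-embedding if for every $x^*\in C(K)^*$ with $\|x^*\|=1$ there is exactly one $y^*\in C(S)^*$ with $T^*(y^*)=x^*$ and $\|y^*\|=\|x^*\|$. Then $T$ is a U-embedding if and only if there exist a closed subset $S_0\subset S$, a homeomorphism $h\colon K\to S_0$ and a continuous function $\varepsilon\colon K\to\{\pm1\}$ such that (i) $F_T(h(k))=\varepsilon(k)\,\delta_k$ for every $k\in K$, and (ii) $\|F_T(s)\|<1$ for every $s\in S\setminus S_0$. -/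

import Mathlib

section

variable {X Y : Type*} [NormedAddCommGroup X] [NormedSpace ℝ X]
  [NormedAddCommGroup Y] [NormedSpace ℝ Y]

/-- The adjoint `T* : Y* → X*` of a linear isometry into `T : X → Y`, given by
`T*(y*) = y* ∘ T`. -/
noncomputable def dualAdjoint (T : X →ₗᵢ[ℝ] Y) : StrongDual ℝ Y →L[ℝ] StrongDual ℝ X :=
  (ContinuousLinearMap.compL ℝ X Y ℝ).flip T.toContinuousLinearMap

@[simp] theorem dualAdjoint_apply (T : X →ₗᵢ[ℝ] Y) (y' : StrongDual ℝ Y) (x : X) :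
    dualAdjoint T y' x = y' (T x) := rfl

/-- `y'` is a Hahn-Banach (that is, norm-preserving) extension of `x'` through `T`. -/
def IsHahnBanachExtension (T : X →ₗᵢ[ℝ] Y) (x' : StrongDual ℝ X) (y' : StrongDual ℝ Y) : Prop :=
  dualAdjoint T y' = x' ∧ ‖y'‖ = ‖x'‖

/-- A linear isometry into is a U-embedding if every functional in the dual unit sphere has a
unique Hahn-Banach extension through it. -/
def IsUEmbedding (T : X →ₗᵢ[ℝ] Y) : Prop :=
  ∀ x' : StrongDual ℝ X, ‖x'‖ = 1 → ∃! y' : StrongDual ℝ Y, IsHahnBanachExtension T x' y'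

/-- The Dirac functional `δ_k ∈ C(K)*`, `f ↦ f k`. -/
noncomputable def diracFunctional {K : Type*} [TopologicalSpace K] [CompactSpace K] (k : K) :
    StrongDual ℝ C(K, ℝ) :=
  ContinuousMap.evalCLM ℝ k

@[simp] theorem diracFunctional_apply {K : Type*} [TopologicalSpace K] [CompactSpace K] (k : K)
    (f : C(K, ℝ)) : diracFunctional k f = f k := rfl

/-- The map `F_T = T* ∘ δ : S → X*` associated with an isometric embedding `T : X → C(S)`. -/
noncomputable def dualRepr {S : Type*} [TopologicalSpace S] [CompactSpace S]
    (T : X →ₗᵢ[ℝ] C(S, ℝ)) (s : S) : StrongDual ℝ X :=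
  dualAdjoint T (diracFunctional s)

end

/-! Write `R g = ε · (g ∘ h)` and `F_T` for `dualRepr T`. If `T f ∘ h = ε f` with `ε² = 1`, then `R
∘ T = id` and `x ∘ R` is a Hahn-Banach extension of each `x`. It is the only one if `‖F_T‖ < 1` off
`h(K)`: an extension `y` of the same norm is dominated by a measure `μ` of mass `‖y‖`, and `‖y‖ ≤ ∫
‖F_T‖ dμ` concentrates `μ` on `{‖F_T‖ = 1}`, so `y` kills `g - T (R g)`. Conversely, Holsztyński's
lemma supplies `h k` with `F_T (h k) = ±δ_k`. Uniqueness of the extension of `δ_k` determines `h k`,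
so `h` has closed graph and is continuous. If `‖F_T s‖ = 1`, then `δ_s` and `F_T s ∘ R` both extend
`F_T s`; they coincide only if `s ∈ h(K)`. -/

open MeasureTheory

/-! ### Domination of functionals by measures -/

/-- A bounded functional on `C(S)` is dominated by a positive one taking the value `‖φ‖` at `1`. -/
theorem exists_positive_dominating {S : Type*} [TopologicalSpace S] [CompactSpace S]
    [Nonempty S] (φ : StrongDual ℝ C(S, ℝ)) :
    ∃ Λ : C(S, ℝ) →ₗ[ℝ] ℝ, Λ 1 = ‖φ‖ ∧ ∀ a b : C(S, ℝ), |b| ≤ a → |φ b| ≤ Λ a := by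
  obtain ⟨s₀⟩ := ‹Nonempty S›
  let cone : PointedCone ℝ (C(S, ℝ) × C(S, ℝ)) :=
    { carrier := {p | |p.2| ≤ p.1}
      add_mem' := fun {p q} hp hq => (abs_add_le p.2 q.2).trans (add_le_add hp hq)
      zero_mem' := by simp
      smul_mem' := fun c p hp => by
        intro s
        have := hp s
        change |(c : ℝ) * p.2 s| ≤ (c : ℝ) * p.1 s
        rw [abs_mul, abs_of_nonneg c.2]
        exact mul_le_mul_of_nonneg_left this c.2 }
  let D : Submodule ℝ (C(S, ℝ) × C(S, ℝ)) :=
    (Submodule.span ℝ {(1 : C(S, ℝ))}).comap (LinearMap.fst ℝ _ _)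
  -- First coordinates in `D` are constant, so on `D` evaluation at `s₀` only reads off that
  -- constant.
  let F : C(S, ℝ) × C(S, ℝ) →ₗ[ℝ] ℝ :=
    (‖φ‖ • (ContinuousMap.evalCLM ℝ s₀).toLinearMap).coprod φ.toLinearMap
  have hF (p) : F p = ‖φ‖ * p.1 s₀ + φ p.2 := by simp [F]
  obtain ⟨G, hG, hpos⟩ := riesz_extension cone ⟨D, F.domRestrict D⟩ (by
      rintro ⟨⟨a, b⟩, hp⟩ hab
      obtain ⟨c, rfl⟩ := Submodule.mem_span_singleton.1 hp
      change 0 ≤ F (c • 1, b)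
      replace hab : ∀ s, |b s| ≤ c := fun s => by simpa using hab s
      have hc : 0 ≤ c := (abs_nonneg _).trans (hab s₀)
      have hb : ‖b‖ ≤ c := (ContinuousMap.norm_le _ hc).2 hab
      have h1 := neg_le_of_abs_le ((φ.le_opNorm b).trans
        (mul_le_mul_of_nonneg_left hb (norm_nonneg φ)))
      rw [hF]
      simp
      linarith) (by
      rintro ⟨a, b⟩
      refine ⟨⟨((‖a‖ + ‖b‖) • 1, 0), Submodule.smul_mem _ _ (Submodule.mem_span_singleton_self _)⟩,
        fun s => ?_⟩
      have ha := neg_le_of_abs_le (a.norm_coe_le_norm s)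
      have hb := b.norm_coe_le_norm s
      rw [Real.norm_eq_abs] at hb
      change |(0 : ℝ) + b s| ≤ (‖a‖ + ‖b‖) * 1 + a s
      rw [zero_add]
      linarith)
  have hφ (b) : G (0, b) = φ b := by
    rw [hG ⟨(0, b), (Submodule.zero_mem _ : (0 : C(S, ℝ)) ∈ Submodule.span ℝ {1})⟩]
    exact (hF _).trans (by simp)
  have hadd (a b) : G (a, b) = G (a, 0) + φ b := by
    rw [← hφ, ← map_add]; simp
  refine ⟨G.comp (LinearMap.inl ℝ _ _), ?_, fun a b hab => ?_⟩
  · change G (1, 0) = _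
    rw [hG ⟨(1, 0), Submodule.mem_span_singleton_self _⟩]
    exact (hF _).trans (by simp)
  · have h1 := hpos (a, b) hab
    have h2 := hpos (a, -b) (by change |-b| ≤ a; rwa [abs_neg])
    rw [hadd] at h1 h2
    rw [map_neg] at h2
    change |φ b| ≤ G (a, 0)
    exact abs_le.2 ⟨by linarith, by linarith⟩

open CompactlySupported in
/-- A bounded functional on `C(S)` is dominated by a finite measure of total mass `‖φ‖`. -/
theorem exists_measure_dominating {S : Type*} [TopologicalSpace S] [CompactSpace S] [T2Space S]
    [Nonempty S] [MeasurableSpace S] [BorelSpace S] (φ : StrongDual ℝ C(S, ℝ)) :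
    ∃ μ : Measure S, IsFiniteMeasure μ ∧ μ.real Set.univ = ‖φ‖ ∧
      ∀ g : C(S, ℝ), |φ g| ≤ ∫ s, |g s| ∂μ := by
  obtain ⟨Λ, h1, hΛ⟩ := exists_positive_dominating φ
  let P : C_c(S, ℝ) →ₚ[ℝ] ℝ := PositiveLinearMap.mk₀
    { toFun := fun f => Λ f.toContinuousMap
      map_add' := fun f g => Λ.map_add f.toContinuousMap g.toContinuousMap
      map_smul' := fun c f => Λ.map_smul c f.toContinuousMap }
    fun f hf => by
      have hf' : |(0 : C(S, ℝ))| ≤ f.toContinuousMap := by rw [abs_zero]; exact fun s => hf s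
      exact (abs_nonneg _).trans (hΛ f.toContinuousMap 0 hf')
  have hP (g : C(S, ℝ)) : ∫ s, g s ∂(RealRMK.rieszMeasure P) = Λ g :=
    RealRMK.integral_rieszMeasure P (CompactlySupportedContinuousMap.continuousMapEquiv g)
  refine ⟨RealRMK.rieszMeasure P, inferInstance, ?_, fun g => ?_⟩
  · rw [← h1, ← hP]; simp
  · exact (hΛ |g| g le_rfl).trans_eq (hP |g|).symm

theorem continuous_of_isClosed_setOf_eq {X Y : Type*} [TopologicalSpace X] [TopologicalSpace Y]
    [CompactSpace Y] {f : X → Y}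
    (hf : IsClosed {p : X × Y | p.2 = f p.1}) : Continuous f := by
  refine continuous_iff_isClosed.2 fun C hC => ?_
  have := isClosedMap_fst_of_compactSpace (X := X) (Y := Y) _
    (hf.inter (hC.preimage continuous_snd))
  convert this using 1
  ext x
  simp

theorem norm_diracFunctional {K : Type*} [TopologicalSpace K] [CompactSpace K]
    (k : K) : ‖diracFunctional k‖ = 1 := by
  have : Nonempty K := ⟨k⟩
  refine le_antisymm (ContinuousLinearMap.opNorm_le_bound _ zero_le_one fun f => ?_) ?_
  · rw [one_mul]; exact f.norm_coe_le_norm k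
  · simpa using (diracFunctional k).le_opNorm 1

theorem norm_dualRepr_le {S : Type*} [TopologicalSpace S] [CompactSpace S]
    {X : Type*} [NormedAddCommGroup X] [NormedSpace ℝ X]
    (T : X →ₗᵢ[ℝ] C(S, ℝ)) (s : S) : ‖dualRepr T s‖ ≤ 1 :=
  ContinuousLinearMap.opNorm_le_bound _ zero_le_one fun x => by
    rw [one_mul, ← T.norm_map x]; exact (T x).norm_coe_le_norm s

theorem norm_dualAdjoint_le {X Y : Type*} [NormedAddCommGroup X] [NormedSpace ℝ X]
    [NormedAddCommGroup Y] [NormedSpace ℝ Y] (T : X →ₗᵢ[ℝ] Y) (y : StrongDual ℝ Y) :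
    ‖dualAdjoint T y‖ ≤ ‖y‖ :=
  ContinuousLinearMap.opNorm_le_bound _ (norm_nonneg _) fun x => by
    rw [← T.norm_map x]; exact y.le_opNorm _

/-! ### Isometries and peak points -/

/-- Holsztyński's lemma: every point evaluation on `K` is, up to sign, of the form `T* δ_s`. -/
theorem exists_dualRepr_eq {K S : Type*} [TopologicalSpace K] [CompactSpace K]
    [TopologicalSpace S] [CompactSpace S] (T : C(K, ℝ) →ₗᵢ[ℝ] C(S, ℝ)) (k : K) :
    ∃ s, |T 1 s| = 1 ∧ ∀ f, T f s = T 1 s * f k := by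
  have : Nonempty K := ⟨k⟩
  let P := {f : C(K, ℝ) // ‖f‖ ≤ 1 ∧ f k = 1}
  have hone : ‖(1 : C(K, ℝ))‖ ≤ 1 ∧ (1 : C(K, ℝ)) k = 1 := ⟨norm_one.le, rfl⟩
  let A : P → Set S := fun f => {s | 1 ≤ |T f.1 s|}
  have : Nonempty P := ⟨⟨1, hone⟩⟩
  have hle (f : P) (s : S) : |T f.1 s| ≤ 1 :=
    ((T f.1).norm_coe_le_norm s).trans ((T.norm_map _).trans_le f.2.1)
  let mid : P → P → P := fun f g => ⟨(2⁻¹ : ℝ) • (f.1 + g.1), by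
    rw [norm_smul]
    have := norm_add_le f.1 g.1
    have := f.2.1
    have := g.2.1
    norm_num
    linarith, by simp [f.2.2, g.2.2]; norm_num⟩
  have hmid (f g : P) (s : S) : T (mid f g).1 s = 2⁻¹ * (T f.1 s + T g.1 s) := by
    simp only [mid, map_smul, map_add]; rfl
  have hclosed (f : P) : IsClosed (A f) :=
    isClosed_le continuous_const (T f.1).continuous.abs
  -- Both values lie in `[-1, 1]`, so their mean reaches modulus one only if they are the same
  -- endpoint. This makes the sets `A f` directed and all `T f s` equal at a common point.
  have hmid_mem {f g : P} {s : S} (hs : s ∈ A (mid f g)) : T f.1 s = T g.1 s ∧ s ∈ A f := by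
    have h1 : 1 ≤ |T (mid f g).1 s| := hs
    rw [hmid] at h1
    have hf := abs_le.1 (hle f s)
    have hg := abs_le.1 (hle g s)
    rcases le_abs.1 h1 with h | h
    · exact ⟨by linarith, show (1 : ℝ) ≤ |T f.1 s| from le_abs.2 (Or.inl (by linarith))⟩
    · exact ⟨by linarith, show (1 : ℝ) ≤ |T f.1 s| from le_abs.2 (Or.inr (by linarith))⟩
  obtain ⟨s, hs⟩ := IsCompact.nonempty_iInter_of_directed_nonempty_isCompact_isClosed A
    (fun f g => ⟨mid f g, fun s hs => (hmid_mem hs).2, fun s hs => by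
      have := hmid_mem hs
      change 1 ≤ |T g.1 s|
      rw [← this.1]; exact this.2⟩)
    (fun f => by
      by_contra hne
      have hlt : ∀ s, ‖T f.1 s‖ < 1 := fun s => by
        by_contra! h; exact hne ⟨s, h⟩
      have h1 : ‖T f.1‖ < 1 := (ContinuousMap.norm_lt_iff _ one_pos).2 hlt
      have h2 := f.1.norm_coe_le_norm k
      rw [f.2.2, norm_one] at h2
      rw [T.norm_map] at h1
      linarith)
    (fun f => (hclosed f).isCompact) hclosed
  rw [Set.mem_iInter] at hs
  have heq (f : P) : T f.1 s = T 1 s := (hmid_mem (g := ⟨1, hone⟩) (hs _)).1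
  have hball (f : C(K, ℝ)) (hf : ‖f‖ ≤ 1) (hk : f k = 0) : T f s = 0 := by
    -- Perturbing `f` and `-f` by the same `1 - |f|` lands both in `P`; subtracting the two equal
    -- values isolates `T f s`.
    have hmem (g : C(K, ℝ)) (hg : ‖g‖ ≤ 1) (hk : g k = 0) :
        ‖g + (1 - |g|)‖ ≤ 1 ∧ (g + (1 - |g|)) k = 1 := by
      refine ⟨(ContinuousMap.norm_le _ zero_le_one).2 fun x => ?_, by simp [hk]⟩
      have hx := (g.norm_coe_le_norm x).trans hg
      rw [Real.norm_eq_abs] at hx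
      change |g x + (1 - |g x|)| ≤ 1
      have := neg_abs_le (g x)
      have := le_abs_self (g x)
      exact abs_le.2 ⟨by linarith, by linarith⟩
    have h1 := heq ⟨_, hmem f hf hk⟩
    have h2 := heq ⟨_, hmem (-f) (by rwa [norm_neg]) (by simp [hk])⟩
    simp only [map_add, map_neg, abs_neg, ContinuousMap.add_apply, ContinuousMap.neg_apply]
      at h1 h2
    linarith
  refine ⟨s, le_antisymm (hle ⟨1, hone⟩ s) (hs ⟨1, hone⟩), fun f => ?_⟩
  have hvanish (f : C(K, ℝ)) (hk : f k = 0) : T f s = 0 := by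
    by_cases hf : f = 0
    · simp [hf]
    have hn : ‖f‖ ≠ 0 := norm_ne_zero_iff.2 hf
    have := hball (‖f‖⁻¹ • f) (by simp [norm_smul, hn]) (by simp [hk])
    simpa [hn] using this
  have := hvanish (f - f k • 1) (by simp)
  simp only [map_sub, map_smul, ContinuousMap.sub_apply, ContinuousMap.smul_apply,
    smul_eq_mul] at this
  linarith

/-- The norm is the supremum of the continuous functions `|T x|` over the unit ball, hence lower
semicontinuous. -/
theorem measurable_norm_dualRepr {S : Type*} [TopologicalSpace S] [CompactSpace S]
    [MeasurableSpace S] [BorelSpace S] {X : Type*} [NormedAddCommGroup X] [NormedSpace ℝ X]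
    (T : X →ₗᵢ[ℝ] C(S, ℝ)) : Measurable fun s => ‖dualRepr T s‖ := by
  refine LowerSemicontinuous.measurable fun s c hc => ?_
  obtain ⟨x, hx, hcx⟩ := (dualRepr T s).exists_lt_apply_of_lt_opNorm hc
  have hev := (T x).continuous.norm.continuousAt.eventually (lt_mem_nhds hcx)
  filter_upwards [hev] with t ht
  exact ht.trans_le ((dualRepr T t).unit_le_opNorm x hx.le)

/-- A functional whose norm is preserved by `T*` vanishes on every function that is zero wherever
`T* δ_s` has norm one. -/
theorem apply_eq_zero_of_norm_dualAdjoint_eq {S : Type*} [TopologicalSpace S] [CompactSpace S]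
    [T2Space S] {X : Type*} [NormedAddCommGroup X] [NormedSpace ℝ X]
    (T : X →ₗᵢ[ℝ] C(S, ℝ)) {y : StrongDual ℝ C(S, ℝ)} (hy : ‖dualAdjoint T y‖ = ‖y‖)
    {g : C(S, ℝ)} (hg : ∀ s, ‖dualRepr T s‖ = 1 → g s = 0) : y g = 0 := by
  cases isEmpty_or_nonempty S
  · rw [show g = 0 from ContinuousMap.ext fun s => isEmptyElim s, map_zero]
  borelize S
  obtain ⟨μ, hfin, hμ, hdom⟩ := exists_measure_dominating y
  have hint : Integrable (fun s => ‖dualRepr T s‖) μ :=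
    Integrable.of_bound (measurable_norm_dualRepr T).aestronglyMeasurable 1
      (Filter.Eventually.of_forall fun s => by rw [norm_norm]; exact norm_dualRepr_le T s)
  have hcont (g : C(S, ℝ)) : Integrable (fun s => |g s|) μ :=
    g.continuous.abs.integrable_of_hasCompactSupport (HasCompactSupport.of_compactSpace _)
  have hge : ‖y‖ ≤ ∫ s, ‖dualRepr T s‖ ∂μ := by
    rw [← hy]
    refine ContinuousLinearMap.opNorm_le_bound _
      (integral_nonneg fun s => norm_nonneg _) fun x => ?_
    rw [← integral_mul_const]
    exact (hdom (T x)).trans (integral_mono (hcont _) (hint.mul_const _)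
      fun s => (dualRepr T s).le_opNorm x)
  have hzero : ∫ s, (1 - ‖dualRepr T s‖) ∂μ = 0 := by
    refine le_antisymm ?_ (integral_nonneg fun s => sub_nonneg.2 (norm_dualRepr_le T s))
    rw [integral_sub (integrable_const _) hint]
    simp [hμ, hge]
  have hae := (integral_eq_zero_iff_of_nonneg
    (fun s => sub_nonneg.2 (norm_dualRepr_le T s)) ((integrable_const _).sub hint)).1 hzero
  refine abs_nonpos_iff.1 ((hdom g).trans_eq (integral_eq_zero_of_ae ?_))
  filter_upwards [hae] with s hs
  have hs' : 1 - ‖dualRepr T s‖ = 0 := hs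
  simp [hg s (by linarith)]

/-! ### Extensions by weighted composition -/

/-- The weighted composition operator `g ↦ ε · (g ∘ h)`. -/
noncomputable def weightedComp {K S : Type*} [TopologicalSpace K] [CompactSpace K]
    [TopologicalSpace S] [CompactSpace S] (ε : C(K, ℝ)) (h : C(K, S)) :
    C(S, ℝ) →L[ℝ] C(K, ℝ) :=
  LinearMap.mkContinuous
    { toFun := fun g => ε * g.comp h
      map_add' := fun f g => by ext; simp [mul_add]
      map_smul' := fun c f => by ext; simp } ‖ε‖ fun g =>
    (norm_mul_le _ _).trans <| mul_le_mul_of_nonneg_left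
      ((ContinuousMap.norm_le _ (norm_nonneg g)).2 fun _ => g.norm_coe_le_norm _) (norm_nonneg ε)

theorem isHahnBanachExtension_comp_weightedComp {K S : Type*} [TopologicalSpace K]
    [CompactSpace K] [TopologicalSpace S] [CompactSpace S] {T : C(K, ℝ) →ₗᵢ[ℝ] C(S, ℝ)}
    {ε : C(K, ℝ)} {h : C(K, S)} (hε : ∀ k, ε k * ε k = 1) (hT : ∀ k f, T f (h k) = ε k * f k)
    (x : StrongDual ℝ C(K, ℝ)) : IsHahnBanachExtension T x (x.comp (weightedComp ε h)) := by
  have hadj : dualAdjoint T (x.comp (weightedComp ε h)) = x := by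
    ext f
    change x (ε * (T f).comp h) = x f
    congr 1
    ext k
    simp [hT, ← mul_assoc, hε]
  have hε1 : ‖ε‖ ≤ 1 := (ContinuousMap.norm_le _ zero_le_one).2 fun k => by
    rw [Real.norm_eq_abs, abs_le_one_iff_mul_self_le_one, hε]
  refine ⟨hadj, le_antisymm ?_ ?_⟩
  · refine (x.opNorm_comp_le _).trans (mul_le_of_le_one_right (norm_nonneg x) ?_)
    exact (LinearMap.mkContinuous_norm_le _ (norm_nonneg ε) _).trans hε1
  · simpa only [hadj] using norm_dualAdjoint_le T (x.comp (weightedComp ε h))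

theorem isUEmbedding_of_weightedComp {K S : Type*} [TopologicalSpace K] [CompactSpace K]
    [TopologicalSpace S] [CompactSpace S] [T2Space S] {T : C(K, ℝ) →ₗᵢ[ℝ] C(S, ℝ)}
    {ε : C(K, ℝ)} {h : C(K, S)} (hε : ∀ k, ε k * ε k = 1) (hT : ∀ k f, T f (h k) = ε k * f k)
    (hlt : ∀ s, s ∉ Set.range h → ‖dualRepr T s‖ < 1) : IsUEmbedding T := by
  refine fun x _ => ⟨_, isHahnBanachExtension_comp_weightedComp hε hT x, fun y hy => ?_⟩
  ext g
  have hzero := apply_eq_zero_of_norm_dualAdjoint_eq T (y := y) (hy.1 ▸ hy.2.symm)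
    (g := g - T (weightedComp ε h g)) fun s hs => by
      have hmem : s ∈ Set.range h := by
        by_contra hmem; exact (hlt s hmem).ne hs
      obtain ⟨k, rfl⟩ := hmem
      change g (h k) - T (ε * g.comp h) (h k) = 0
      simp [hT, ← mul_assoc, hε]
  rw [map_sub, sub_eq_zero] at hzero
  rw [hzero, ← hy.1]
  rfl

/-- Both `T 1 s • δ_s` and `T 1 t • δ_t` are Hahn-Banach extensions of `δ_k`. -/
theorem IsUEmbedding.eq_of_apply_eq {K S : Type*} [TopologicalSpace K] [CompactSpace K]
    [TopologicalSpace S] [CompactSpace S] [T2Space S] {T : C(K, ℝ) →ₗᵢ[ℝ] C(S, ℝ)}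
    (hT : IsUEmbedding T) {k : K} {s t : S} (hs : |T 1 s| = 1) (ht : |T 1 t| = 1)
    (hsT : ∀ f, T f s = T 1 s * f k) (htT : ∀ f, T f t = T 1 t * f k) : s = t := by
  have hext {s : S} (hs : |T 1 s| = 1) (hsT : ∀ f, T f s = T 1 s * f k) :
      IsHahnBanachExtension T (diracFunctional k) (T 1 s • diracFunctional s) := by
    refine ⟨?_, by rw [norm_smul, norm_diracFunctional, norm_diracFunctional, mul_one,
      Real.norm_eq_abs, hs]⟩
    ext f
    change T 1 s * T f s = f k
    rw [hsT f, ← mul_assoc, ← abs_mul_abs_self, hs, one_mul, one_mul]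
  have heq := (hT _ (norm_diracFunctional k)).unique (hext hs hsT) (hext ht htT)
  have heval (g : C(S, ℝ)) : T 1 s * g s = T 1 t * g t := DFunLike.congr_fun heq g
  have h1 : T 1 s = T 1 t := by simpa using heval 1
  have hne : T 1 t ≠ 0 := fun h0 => by simp [h0] at ht
  by_contra hst
  obtain ⟨g, hg0, hg1, -⟩ := exists_continuous_zero_one_of_isClosed
    (isClosed_singleton (x := s)) (isClosed_singleton (x := t))
    (Set.disjoint_singleton.2 hst)
  have := heval g
  rw [h1, hg0 rfl, hg1 rfl] at this
  exact hne (by simpa using this.symm)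

/-- A U-embedding of `C(K)` into `C(S)` is inverted by a weighted composition operator, and
`T* δ_s` has norm less than one off the range of its symbol. -/
theorem IsUEmbedding.exists_weightedComp {K S : Type*} [TopologicalSpace K] [CompactSpace K]
    [T2Space K] [TopologicalSpace S] [CompactSpace S] [T2Space S] {T : C(K, ℝ) →ₗᵢ[ℝ] C(S, ℝ)}
    (hT : IsUEmbedding T) : ∃ (ε : C(K, ℝ)) (h : C(K, S)), (∀ k, ε k * ε k = 1) ∧
      (∀ k f, T f (h k) = ε k * f k) ∧ Function.Injective h ∧
      ∀ s, s ∉ Set.range h → ‖dualRepr T s‖ < 1 := by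
  choose h habs hrep using exists_dualRepr_eq T
  have hcont : Continuous h := by
    refine continuous_of_isClosed_setOf_eq ?_
    -- The defining conditions of `h k` are closed in `(k, s)` and, by uniqueness, cut out exactly
    -- the graph.
    have hset : {p : K × S | p.2 = h p.1} =
        {p | |T 1 p.2| = 1} ∩ ⋂ f : C(K, ℝ), {p | T f p.2 = T 1 p.2 * f p.1} := by
      ext ⟨k, s⟩
      simp only [Set.mem_inter_iff, Set.mem_iInter, Set.mem_ofPred_eq]
      exact ⟨fun hs => hs ▸ ⟨habs k, hrep k⟩,
        fun hs => hT.eq_of_apply_eq hs.1 (habs k) hs.2 (hrep k)⟩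
    rw [hset]
    refine (isClosed_eq (by fun_prop) continuous_const).inter
      (isClosed_iInter fun f => isClosed_eq (by fun_prop) (by fun_prop))
  let ε : C(K, ℝ) := (T 1).comp ⟨h, hcont⟩
  have hε (k) : ε k * ε k = 1 := by
    rw [← abs_mul_abs_self]
    change |T 1 (h k)| * |T 1 (h k)| = 1
    rw [habs, one_mul]
  refine ⟨ε, ⟨h, hcont⟩, hε, hrep, fun k l hkl => ?_, fun s hs => ?_⟩
  · change h k = h l at hkl
    by_contra hne
    obtain ⟨f, hf0, hf1, -⟩ := exists_continuous_zero_one_of_isClosed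
      (isClosed_singleton (x := k)) (isClosed_singleton (x := l))
      (Set.disjoint_singleton.2 hne)
    have h1 := hrep k f
    rw [hkl, hrep l f, hf0 rfl, hf1 rfl] at h1
    have h2 : T 1 (h l) = 0 := by simpa using h1
    simpa [h2] using habs l
  · refine (norm_dualRepr_le T s).lt_of_ne fun hs1 => ?_
    have heq := (hT _ hs1).unique (y₁ := diracFunctional s)
      ⟨rfl, by rw [norm_diracFunctional, hs1]⟩
      (isHahnBanachExtension_comp_weightedComp (h := ⟨h, hcont⟩) hε hrep _)
    obtain ⟨g, hg0, hg1, -⟩ := exists_continuous_zero_one_of_isClosed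
      (isCompact_range hcont).isClosed (isClosed_singleton (x := s))
      (Set.disjoint_singleton_right.2 hs)
    have hR : weightedComp ε ⟨h, hcont⟩ g = 0 := by
      ext k
      change ε k * g (h k) = 0
      rw [hg0 ⟨k, rfl⟩]
      simp
    have h1 : g s = dualRepr T s (weightedComp ε ⟨h, hcont⟩ g) := DFunLike.congr_fun heq g
    rw [hR, map_zero, hg1 rfl] at h1
    exact one_ne_zero h1

theorem mainTheorem1 {K S : Type*}
    [TopologicalSpace K] [CompactSpace K] [T2Space K]
    [TopologicalSpace S] [CompactSpace S] [T2Space S]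
    (T : C(K, ℝ) →ₗᵢ[ℝ] C(S, ℝ)) :
    IsUEmbedding T ↔
      ∃ S₀ : Set S, IsClosed S₀ ∧
        ∃ (h : K ≃ₜ S₀) (ε : K → ℝ),
          Continuous ε ∧ (∀ k, ε k = 1 ∨ ε k = -1) ∧
          (∀ k, dualRepr T (h k : S) = ε k • diracFunctional k) ∧
          (∀ s, s ∉ S₀ → ‖dualRepr T s‖ < 1) := by
  constructor
  · intro hT
    obtain ⟨ε, h, hε, hrep, hinj, hlt⟩ := hT.exists_weightedComp
    have hemb := h.continuous.isClosedEmbedding hinj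
    exact ⟨Set.range h, hemb.isClosed_range, hemb.isEmbedding.toHomeomorph, ε, ε.continuous,
      fun k => mul_self_eq_one_iff.1 (hε k), fun k => ContinuousLinearMap.ext (hrep k), hlt⟩
  · rintro ⟨S₀, -, h, ε, hεc, hε, hrep, hlt⟩
    refine isUEmbedding_of_weightedComp (ε := ⟨ε, hεc⟩)
      (h := ⟨fun k => (h k : S), continuous_subtype_val.comp h.continuous⟩)
      (fun k => mul_self_eq_one_iff.2 (hε k)) (fun k f => DFunLike.congr_fun (hrep k) f)
      fun s hs => hlt s fun hmem => hs ⟨h.symm ⟨s, hmem⟩, by simp⟩
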